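/- Let $D_1,\dots,D_m\subseteq\mathbb R^n$ be nonempty, closed and convex, and let $d_{D_i}$ denote the Euclidean distance to $D_i$. Let $\Theta$ be the set of level-bounded continuous concave functions $\psi:\mathbb R_+\to\mathbb R_+$ with $\psi(0)=0$ that are continuously differentiable with positive derivative on $(0,\infty)$, for which $\lim_{s\downarrow0}\psi'(s)$ exists and is positive, and whose right derivative $\psi'_+$ is Lipschitz continuous on $\mathbb R_+$. Let $\psi\in\Theta$ be strictly concave on $\mathbb R_+$, put $$\Psi(x)=\sum_{i=1}^m\psi\big(d_{D_i}(x)^2\big),\qquad x\in\mathbb R^n,$$ let $\rho:\mathbb R\to\mathbb R$ be given by $\rho(s)=-\psi(s)$ for $s\ge0$ and $\rho(s)=s^2-\psi'_+(0)\,s$ for $s<0$, let $\rho^*(u)=\sup_{s\in\mathbb R}\,(us-\rho(s))$ be its convex conjugate, and define the lifted potential on $\mathbb R^n\times(\mathbb R^n)^m\times\mathbb R^m$ (with its Euclidean structure) by $$F(x,\xi,u)=\sum_{i=1}^m\Big[\rho^*(u_i)-u_i\|x-\xi_i\|^2+\delta_{D_i}(\xi_i)\Big],$$ where $\delta_{D_i}$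 is $0$ on $D_i$ and $+\infty$ elsewhere. For a proper lower semicontinuous $f$ with values in $(-\infty,\infty]$ let $\partial f$ be the limiting subdifferential and ${\rm dom}\,\partial f=\{x:\partial f(x)\ne\emptyset\}$. Such an $f$ is said to satisfy the KL property with exponent $\theta\in[0,1)$ if for each $\hat x\in{\rm dom}\,\partial f$ there are $c>0$, $\nu\in(0,\infty]$ and a neighbourhood $\mathcal N$ of $\hat x$ such that, with $\phi(s)=c\,s^{1-\theta}$, $$\phi'\big(f(x)-f(\hat x)\big)\,{\rm dist}\big(0,\partial f(x)\big)\ge1\quad\text{whenever } x\in\mathcal N \text{ and } f(\hat x)<f(x)<f(\hat x)+\nu$$ (where ${\rm dist}(0,\emptyset)=\infty$). Let $\theta\in[\tfrac12,1)$. If $\Psi$ satisfies the KL property with exponent $\theta$, then $F$ is proper and lower semicontinuous and satisfies the KL property with exponent $\theta$. -/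

import Mathlib

open Set Filter Topology
open scoped NNReal ENNReal

noncomputable section

namespace KLLift

/-! ### Extended-real-valued functions and their subdifferentials -/

section Subdifferential

variable {E : Type*} [NormedAddCommGroup E] [InnerProductSpace ℝ E]

/-- `f` is proper: it is never `-∞` and it is finite somewhere. -/
def IsProper (f : E → EReal) : Prop :=
  (∃ x, f x < ⊤) ∧ ∀ x, f x ≠ ⊥

/-- The regular (Fréchet) subdifferential; it is empty outside the domain of `f`. -/
def regularSubdiff (f : E → EReal) (a : E) : Set E :=
  {v | f a < ⊤ ∧
    0 ≤ liminf (fun x : E =>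
      (f x - f a - ((inner ℝ v (x - a) : ℝ) : EReal)) / ((‖x - a‖ : ℝ) : EReal)) (𝓝[≠] a)}

/-- The limiting (Mordukhovich) subdifferential; it is empty outside the domain of `f`. -/
def limitingSubdiff (f : E → EReal) (a : E) : Set E :=
  {v | f a < ⊤ ∧ ∃ (x : ℕ → E) (w : ℕ → E),
    Tendsto x atTop (𝓝 a) ∧ Tendsto (fun t => f (x t)) atTop (𝓝 (f a)) ∧
    (∀ t, w t ∈ regularSubdiff f (x t)) ∧ Tendsto w atTop (𝓝 v)}

/-- The domain of the limiting subdifferential. -/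
def domSubdiff (f : E → EReal) : Set E :=
  {x | (limitingSubdiff f x).Nonempty}

/-! ### The Kurdyka-Łojasiewicz property -/

/-- The class of desingularizing functions on `[0, ν)`, for `ν ∈ (0, ∞]`: continuous, concave,
nonnegative, zero at `0`, and continuously differentiable with positive derivative on `(0, ν)`. -/
structure IsDesingularizing (ν : EReal) (φ : ℝ → ℝ) : Prop where
  nonneg : ∀ s : ℝ, 0 ≤ s → (s : EReal) < ν → 0 ≤ φ s
  continuousOn : ContinuousOn φ {s : ℝ | 0 ≤ s ∧ (s : EReal) < ν}
  concaveOn : ConcaveOn ℝ {s : ℝ | 0 ≤ s ∧ (s : EReal) < ν} φ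
  contDiffOn : ContDiffOn ℝ 1 φ {s : ℝ | 0 < s ∧ (s : EReal) < ν}
  deriv_pos : ∀ s : ℝ, 0 < s → (s : EReal) < ν → 0 < deriv φ s
  map_zero : φ 0 = 0

/-- `f` satisfies the KL property at `a ∈ dom ∂f` with the desingularizing function `φ` on
`[0, ν)`. The distance from `0` to the empty set is `∞`. -/
def KLPropertyWith (f : E → EReal) (a : E) (ν : EReal) (φ : ℝ → ℝ) : Prop :=
  a ∈ domSubdiff f ∧ 0 < ν ∧ IsDesingularizing ν φ ∧
    ∃ N ∈ 𝓝 a, ∀ x ∈ N, f a < f x → f x < f a + ν →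
      1 ≤ ENNReal.ofReal (deriv φ (f x - f a).toReal) *
        Metric.infEDist (0 : E) (limitingSubdiff f x)

/-- `f` satisfies the KL property at `a` with exponent `θ`: the desingularizing function can be
chosen as `s ↦ c s ^ (1 - θ)` with `c > 0`. -/
def KLPropertyExponent (f : E → EReal) (a : E) (θ : ℝ) : Prop :=
  ∃ (c : ℝ) (ν : EReal), 0 < c ∧ KLPropertyWith f a ν (fun s => c * s ^ (1 - θ))

/-- A proper closed (lower semicontinuous) function which satisfies the KL property with exponent
`θ` at every point of `dom ∂f`. -/
def IsKLFunctionExponent (f : E → EReal) (θ : ℝ) : Prop :=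
  IsProper f ∧ LowerSemicontinuous f ∧ ∀ a ∈ domSubdiff f, KLPropertyExponent f a θ

end Subdifferential

/-! ### The class `Θ` and the function `ρ` -/

/-- The right derivative of a function of one real variable. -/
def rightDeriv (ψ : ℝ → ℝ) (s : ℝ) : ℝ := derivWithin ψ (Ici s) s

/-- The class `Θ` of functions `ψ : [0, ∞) → [0, ∞)`. The values of `ψ` at negative arguments are
irrelevant. -/
structure MemTheta (ψ : ℝ → ℝ) : Prop where
  nonneg : ∀ s, 0 ≤ s → 0 ≤ ψ s
  levelBounded : ∀ r : ℝ, Bornology.IsBounded {s : ℝ | 0 ≤ s ∧ ψ s ≤ r}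
  continuousOn : ContinuousOn ψ (Ici 0)
  concaveOn : ConcaveOn ℝ (Ici 0) ψ
  contDiffOn : ContDiffOn ℝ 1 ψ (Ioi 0)
  deriv_pos : ∀ s, 0 < s → 0 < deriv ψ s
  map_zero : ψ 0 = 0
  tendsto_deriv : ∃ l : ℝ, 0 < l ∧ Tendsto (deriv ψ) (𝓝[>] 0) (𝓝 l)
  lipschitz : ∃ K : ℝ≥0, LipschitzOnWith K (rightDeriv ψ) (Ici 0)

/-- The function `ρ`, equal to `-ψ(s)` for `s ≥ 0` and to `s² - l s` for `s < 0`, where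
`l = ψ'₊(0)`. -/
def rho (ψ : ℝ → ℝ) (s : ℝ) : ℝ :=
  if 0 ≤ s then -ψ s else s ^ 2 - rightDeriv ψ 0 * s

/-- The convex conjugate of a real function on the line. -/
def conjugate (g : ℝ → ℝ) (u : ℝ) : EReal :=
  ⨆ s : ℝ, ((u * s - g s : ℝ) : EReal)

/-! ### The functions `Ψ` and `F` -/

/-- The indicator function of a set, in the sense of variational analysis. -/
def indicatorFn {E : Type*} (D : Set E) (x : E) : EReal :=
  open Classical in if x ∈ D then 0 else ⊤

/-- `Ψ(x) = ∑ i, ψ(d²(x, D i))`. -/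
def Psi {n m : ℕ} (ψ : ℝ → ℝ) (D : Fin m → Set (EuclideanSpace ℝ (Fin n)))
    (x : EuclideanSpace ℝ (Fin n)) : ℝ :=
  ∑ i, ψ (Metric.infDist x (D i) ^ 2)

/-- The Euclidean space `ℝⁿ × (ℝⁿ)ᵐ × ℝᵐ` of the triples `(x, ξ, u)`, with the standard inner
product and the induced norm. -/
abbrev LiftSpace (n m : ℕ) : Type :=
  WithLp 2 (EuclideanSpace ℝ (Fin n) ×
    WithLp 2 (PiLp 2 (fun _ : Fin m => EuclideanSpace ℝ (Fin n)) × EuclideanSpace ℝ (Fin m)))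

/-- The lifted potential
`F(x, ξ, u) = ∑ i, (ρ*(u i) - u i ‖x - ξ i‖² + δ_{D i}(ξ i))`. No summand is ever `-∞`. -/
def liftedPotential {n m : ℕ} (ψ : ℝ → ℝ) (D : Fin m → Set (EuclideanSpace ℝ (Fin n)))
    (z : LiftSpace n m) : EReal :=
  let x := z.fst
  let ξ := z.snd.fst
  let u := z.snd.snd
  ∑ i, (conjugate (rho ψ) (u i) + ((-(u i * ‖x - ξ i‖ ^ 2) : ℝ) : EReal)
    + indicatorFn (D i) (ξ i))

end KLLift

end

/-! The function ρ is convex and decreasing with Lipschitz derivative, and `Ψ(x)` is the minimum of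
`F(x, ·, ·)`. By Fenchel-Young, `ρ*(u) - u t ≥ -ρ(t)` with equality at `u = ρ'(t)`, and `-ρ`
increases, so the best `ξ i` is the projection of `x` onto `D i` (`Psi_le_liftReal`).

A subgradient `w` of `F` at `z = (x, ξ, u)` satisfies a perturbed form of these optimality
conditions (`LiftSubgradient`): `u i = ρ'(w i + ‖x - ξ i‖²)`, where `w i` is its weight component,
`ξ i` is an approximate projection, and the base component of `w` is an approximate gradient of `Ψ`.
Near a point `a` where `w = 0` is allowed, the weights stay away from 0, and `exists_error_bound`
gives `F(z) - Ψ(x) ≤ C ‖w‖²` together with a subgradient of `Ψ` at `x` of norm at most `C ‖w‖` when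
`‖w‖ ≤ 1`.

Since `s ↦ s ^ θ` is subadditive, `(F(z) - F(a)) ^ θ` is at most `(C ‖w‖²) ^ θ` plus the θ-th power
of the positive part of the increment of `Ψ`. The first term is `O(‖w‖)` because `2θ ≥ 1`, the
second by the KL property of `Ψ`. Near any other point the subgradients of `F` are bounded away from
0, because the relation `LiftSubgradient` is closed. -/

namespace KLLift

/-! ### The function `ρ` -/

/-- The derivative of `ρ`. -/
noncomputable def rhoDeriv (ψ : ℝ → ℝ) (s : ℝ) : ℝ :=
  if 0 ≤ s then -rightDeriv ψ s else 2 * s - rightDeriv ψ 0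

section Rho

variable {ψ : ℝ → ℝ}

lemma MemTheta.differentiableAt (hψ : MemTheta ψ) {s : ℝ} (hs : 0 < s) :
    DifferentiableAt ℝ ψ s :=
  (hψ.contDiffOn.differentiableOn one_ne_zero).differentiableAt (Ioi_mem_nhds hs)

lemma MemTheta.rightDeriv_eq (hψ : MemTheta ψ) {s : ℝ} (hs : 0 < s) :
    rightDeriv ψ s = deriv ψ s :=
  (hψ.differentiableAt hs).derivWithin (uniqueDiffOn_Ici s s self_mem_Ici)

lemma MemTheta.hasDerivWithinAt (hψ : MemTheta ψ) {s : ℝ} (hs : 0 ≤ s) :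
    HasDerivWithinAt ψ (rightDeriv ψ s) (Ici s) s ∧ 0 < rightDeriv ψ s := by
  rcases hs.eq_or_lt with rfl | hs
  · obtain ⟨l, hl, hlim⟩ := hψ.tendsto_deriv
    have h : HasDerivWithinAt ψ l (Ici 0) 0 :=
      hasDerivWithinAt_Ici_of_tendsto_deriv
        (hψ.contDiffOn.differentiableOn one_ne_zero)
        ((hψ.continuousOn 0 self_mem_Ici).mono Ioi_subset_Ici_self) self_mem_nhdsWithin hlim
    have he : rightDeriv ψ 0 = l := h.derivWithin (uniqueDiffOn_Ici 0 0 self_mem_Ici)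
    exact he ▸ ⟨h, hl⟩
  · rw [hψ.rightDeriv_eq hs]
    exact ⟨(hψ.differentiableAt hs).hasDerivAt.hasDerivWithinAt, hψ.deriv_pos s hs⟩

lemma rhoDeriv_of_nonneg {s : ℝ} (hs : 0 ≤ s) : rhoDeriv ψ s = -rightDeriv ψ s := if_pos hs

lemma rhoDeriv_of_nonpos {s : ℝ} (hs : s ≤ 0) : rhoDeriv ψ s = 2 * s - rightDeriv ψ 0 := by
  rcases hs.eq_or_lt with rfl | hs
  · simp [rhoDeriv]
  · exact if_neg hs.not_ge

lemma rho_of_nonneg {s : ℝ} (hs : 0 ≤ s) : rho ψ s = -ψ s := if_pos hs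

lemma MemTheta.rho_of_nonpos (hψ : MemTheta ψ) {s : ℝ} (hs : s ≤ 0) :
    rho ψ s = s ^ 2 - rightDeriv ψ 0 * s := by
  rcases hs.eq_or_lt with rfl | hs
  · simp [rho, hψ.map_zero]
  · exact if_neg hs.not_ge

lemma MemTheta.rhoDeriv_neg (hψ : MemTheta ψ) (s : ℝ) : rhoDeriv ψ s < 0 := by
  have h0 := (hψ.hasDerivWithinAt le_rfl).2
  rcases le_total 0 s with hs | hs
  · rw [rhoDeriv_of_nonneg hs]
    linarith [(hψ.hasDerivWithinAt hs).2]
  · rw [rhoDeriv_of_nonpos hs]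
    linarith

lemma MemTheta.hasDerivAt_rho (hψ : MemTheta ψ) (s : ℝ) :
    HasDerivAt (rho ψ) (rhoDeriv ψ s) s := by
  have hpoly (s : ℝ) :
      HasDerivAt (fun x => x ^ 2 - rightDeriv ψ 0 * x) (2 * s - rightDeriv ψ 0) s := by
    simpa using (hasDerivAt_pow 2 s).fun_sub ((hasDerivAt_id s).const_mul (rightDeriv ψ 0))
  rcases lt_trichotomy s 0 with hs | rfl | hs
  · rw [rhoDeriv_of_nonpos hs.le]
    exact (hpoly s).congr_of_eventuallyEq
      (eventually_of_mem (Iio_mem_nhds hs) fun x hx => hψ.rho_of_nonpos (le_of_lt hx))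
  · have hr : HasDerivWithinAt (rho ψ) (rhoDeriv ψ 0) (Ici 0) 0 := by
      rw [rhoDeriv_of_nonneg le_rfl]
      exact (hψ.hasDerivWithinAt le_rfl).1.neg.congr (fun x hx => rho_of_nonneg hx)
        (rho_of_nonneg le_rfl)
    have hl : HasDerivWithinAt (rho ψ) (rhoDeriv ψ 0) (Iic 0) 0 := by
      rw [rhoDeriv_of_nonpos le_rfl]
      exact (hpoly 0).hasDerivWithinAt.congr (fun x hx => hψ.rho_of_nonpos hx)
        (hψ.rho_of_nonpos le_rfl)
    simpa [Iic_union_Ici] using hl.union hr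
  · rw [rhoDeriv_of_nonneg hs.le, hψ.rightDeriv_eq hs]
    exact (hψ.differentiableAt hs).hasDerivAt.neg.congr_of_eventuallyEq
      (eventually_of_mem (Ioi_mem_nhds hs) fun x hx => rho_of_nonneg (le_of_lt hx))

lemma MemTheta.rightDeriv_antitone (hψ : MemTheta ψ) {a b : ℝ} (ha : 0 ≤ a) (hab : a ≤ b) :
    rightDeriv ψ b ≤ rightDeriv ψ a := by
  rcases hab.eq_or_lt with rfl | hab
  · exact le_rfl
  have hb := ha.trans_lt hab
  rw [hψ.rightDeriv_eq hb]
  exact (hψ.concaveOn.le_slope_of_hasDerivAt (mem_Ici.2 ha) (mem_Ici.2 hb.le) hab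
    (hψ.differentiableAt hb).hasDerivAt).trans
    (hψ.concaveOn.slope_le_of_hasDerivWithinAt_Ioi (mem_Ici.2 ha) (mem_Ici.2 hb.le) hab
    ((hψ.hasDerivWithinAt ha).1.mono Ioi_subset_Ici_self))

lemma MemTheta.rhoDeriv_monotone (hψ : MemTheta ψ) : Monotone (rhoDeriv ψ) := by
  intro a b hab
  rcases le_total 0 a with ha | ha
  · rw [rhoDeriv_of_nonneg ha, rhoDeriv_of_nonneg (ha.trans hab)]
    exact neg_le_neg (hψ.rightDeriv_antitone ha hab)
  · rw [rhoDeriv_of_nonpos ha]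
    rcases le_total 0 b with hb | hb
    · rw [rhoDeriv_of_nonneg hb]
      linarith [hψ.rightDeriv_antitone le_rfl hb]
    · rw [rhoDeriv_of_nonpos hb]
      linarith

/-- The derivative has constant `K` on the right half-line and slope 2 on the left, and the two
branches agree at 0; `K + 2` covers every case. -/
lemma MemTheta.exists_rhoDeriv_lipschitz (hψ : MemTheta ψ) :
    ∃ L : ℝ, 0 ≤ L ∧ ∀ a b, |rhoDeriv ψ a - rhoDeriv ψ b| ≤ L * |a - b| := by
  obtain ⟨K, hK⟩ := hψ.lipschitz
  have key (a b : ℝ) (hab : a ≤ b) : rhoDeriv ψ b - rhoDeriv ψ a ≤ (K + 2) * (b - a) := by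
    have hK' (a b : ℝ) (ha : 0 ≤ a) (hab : a ≤ b) :
        rightDeriv ψ a - rightDeriv ψ b ≤ K * (b - a) := by
      have := hK.dist_le_mul a ha b (ha.trans hab)
      rw [Real.dist_eq, Real.dist_eq, abs_sub_comm a b, abs_of_nonneg (sub_nonneg.2 hab)] at this
      exact (le_abs_self _).trans this
    have hK0 : (0 : ℝ) ≤ K := K.2
    rcases le_total 0 a with ha | ha
    · rw [rhoDeriv_of_nonneg ha, rhoDeriv_of_nonneg (ha.trans hab)]
      linarith [hK' a b ha hab]
    · rw [rhoDeriv_of_nonpos ha]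
      rcases le_total 0 b with hb | hb
      · rw [rhoDeriv_of_nonneg hb]
        have := hK' 0 b le_rfl hb
        nlinarith
      · rw [rhoDeriv_of_nonpos hb]
        nlinarith
  refine ⟨K + 2, by positivity, fun a b => ?_⟩
  rcases le_total a b with hab | hab
  · rw [abs_sub_comm, abs_sub_comm a, abs_of_nonneg (sub_nonneg.2 (hψ.rhoDeriv_monotone hab)),
      abs_of_nonneg (sub_nonneg.2 hab)]
    exact key a b hab
  · rw [abs_of_nonneg (sub_nonneg.2 (hψ.rhoDeriv_monotone hab)), abs_of_nonneg (sub_nonneg.2 hab)]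
    exact key b a hab

lemma MemTheta.continuous_rhoDeriv (hψ : MemTheta ψ) : Continuous (rhoDeriv ψ) := by
  obtain ⟨L, hL, h⟩ := hψ.exists_rhoDeriv_lipschitz
  exact (LipschitzWith.of_dist_le_mul (K := ⟨L, hL⟩) fun a b => h a b).continuous

lemma MemTheta.exists_rho_sub_eq (hψ : MemTheta ψ) (s t : ℝ) :
    ∃ c ∈ uIcc s t, rho ψ t - rho ψ s = rhoDeriv ψ c * (t - s) := by
  have hc : Continuous (rho ψ) :=
    continuous_iff_continuousAt.2 fun s => (hψ.hasDerivAt_rho s).continuousAt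
  rcases lt_trichotomy s t with h | rfl | h
  · obtain ⟨c, hc, he⟩ := exists_hasDerivAt_eq_slope (rho ψ) (rhoDeriv ψ) h hc.continuousOn
      fun x _ => hψ.hasDerivAt_rho x
    refine ⟨c, uIcc_of_le h.le ▸ Ioo_subset_Icc_self hc, ?_⟩
    rw [he, div_mul_cancel₀ _ (sub_pos.2 h).ne']
  · exact ⟨s, left_mem_uIcc, by simp⟩
  · obtain ⟨c, hc, he⟩ := exists_hasDerivAt_eq_slope (rho ψ) (rhoDeriv ψ) h hc.continuousOn
      fun x _ => hψ.hasDerivAt_rho x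
    refine ⟨c, uIcc_of_ge h.le ▸ Ioo_subset_Icc_self hc, ?_⟩
    have := sub_pos.2 h
    rw [he]
    field_simp
    ring

lemma MemTheta.rho_tangent_le (hψ : MemTheta ψ) (s t : ℝ) :
    rhoDeriv ψ s * (t - s) ≤ rho ψ t - rho ψ s := by
  obtain ⟨c, hc, he⟩ := hψ.exists_rho_sub_eq s t
  rw [he]
  rcases le_total s t with h | h
  · rw [uIcc_of_le h] at hc
    exact mul_le_mul_of_nonneg_right (hψ.rhoDeriv_monotone hc.1) (sub_nonneg.2 h)
  · rw [uIcc_of_ge h] at hc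
    exact mul_le_mul_of_nonpos_right (hψ.rhoDeriv_monotone hc.2) (sub_nonpos.2 h)

/-- The descent lemma. The mean value theorem yields `L` in place of the sharp `L / 2`, which is
enough. -/
lemma MemTheta.rho_sub_tangent_le (hψ : MemTheta ψ) {L : ℝ} (hL0 : 0 ≤ L)
    (hL : ∀ a b, |rhoDeriv ψ a - rhoDeriv ψ b| ≤ L * |a - b|) (s t : ℝ) :
    rho ψ t - rho ψ s - rhoDeriv ψ s * (t - s) ≤ L * (t - s) ^ 2 := by
  obtain ⟨c, hc, he⟩ := hψ.exists_rho_sub_eq s t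
  have hcs : |c - s| ≤ |t - s| := abs_sub_left_of_mem_uIcc hc
  calc rho ψ t - rho ψ s - rhoDeriv ψ s * (t - s)
      = (rhoDeriv ψ c - rhoDeriv ψ s) * (t - s) := by rw [he]; ring
    _ ≤ |rhoDeriv ψ c - rhoDeriv ψ s| * |t - s| := by rw [← abs_mul]; exact le_abs_self _
    _ ≤ (L * |t - s|) * |t - s| := by gcongr; exact (hL c s).trans (by gcongr)
    _ = L * (t - s) ^ 2 := by rw [mul_assoc, abs_mul_abs_self, sq]

lemma MemTheta.rho_antitone (hψ : MemTheta ψ) : Antitone (rho ψ) := fun s t h => by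
  have := hψ.rho_tangent_le t s
  nlinarith [hψ.rhoDeriv_neg t]

/-! ### The conjugate of ρ -/

lemma le_conjugate (g : ℝ → ℝ) (u s : ℝ) : ((u * s - g s : ℝ) : EReal) ≤ conjugate g u :=
  le_iSup (fun s : ℝ => ((u * s - g s : ℝ) : EReal)) s

lemma conjugate_ne_bot (g : ℝ → ℝ) (u : ℝ) : conjugate g u ≠ ⊥ :=
  ne_bot_of_le_ne_bot (EReal.coe_ne_bot _) (le_conjugate g u 0)

lemma le_toReal_conjugate {g : ℝ → ℝ} {u : ℝ} (h : conjugate g u ≠ ⊤) (s : ℝ) :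
    u * s - g s ≤ (conjugate g u).toReal := by
  rw [← EReal.coe_le_coe_iff, EReal.coe_toReal h (conjugate_ne_bot g u)]
  exact le_conjugate g u s

lemma conjugate_le_coe {g : ℝ → ℝ} {u c : ℝ} (h : ∀ s, u * s - g s ≤ c) :
    conjugate g u ≤ (c : EReal) :=
  iSup_le fun s => EReal.coe_le_coe_iff.2 (h s)

/-- Tangent lines lie below ρ, so the supremum is attained at `s`. In particular the range of `ρ'`
lies in the domain of the conjugate. -/
lemma MemTheta.conjugate_rhoDeriv (hψ : MemTheta ψ) (s : ℝ) :
    conjugate (rho ψ) (rhoDeriv ψ s) = ((rhoDeriv ψ s * s - rho ψ s : ℝ) : EReal) :=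
  le_antisymm (conjugate_le_coe fun t => by linarith [hψ.rho_tangent_le s t])
    (le_conjugate _ _ _)

/-- The conjugate is convex on its domain. -/
lemma conjugate_convex_comb {g : ℝ → ℝ} {u v t : ℝ} (hu : conjugate g u ≠ ⊤)
    (hv : conjugate g v ≠ ⊤) (h0 : 0 ≤ t) (h1 : t ≤ 1) :
    conjugate g (u + t * (v - u)) ≠ ⊤ ∧ (conjugate g (u + t * (v - u))).toReal ≤
      (conjugate g u).toReal + t * ((conjugate g v).toReal - (conjugate g u).toReal) := by
  have h := conjugate_le_coe (g := g) (u := u + t * (v - u))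
    (c := (conjugate g u).toReal + t * ((conjugate g v).toReal - (conjugate g u).toReal))
    fun s => by
      nlinarith [mul_le_mul_of_nonneg_left (le_toReal_conjugate hu s) (sub_nonneg.2 h1),
        mul_le_mul_of_nonneg_left (le_toReal_conjugate hv s) h0]
  have ht := ne_top_of_le_ne_top (EReal.coe_ne_top _) h
  exact ⟨ht, EReal.coe_le_coe_iff.1 ((EReal.coe_toReal ht (conjugate_ne_bot _ _)).trans_le h)⟩

/-- The subdifferential inequality for the conjugate of `ρ` characterizes `ρ'`. -/
lemma MemTheta.eq_rhoDeriv_of_subgradient (hψ : MemTheta ψ) {u s : ℝ}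
    (hu : conjugate (rho ψ) u ≠ ⊤)
    (h : ∀ v, conjugate (rho ψ) v ≠ ⊤ →
      s * (v - u) ≤ (conjugate (rho ψ) v).toReal - (conjugate (rho ψ) u).toReal) :
    u = rhoDeriv ψ s := by
  -- Testing with `v = ρ'(s)` gives `ρ*(u) ≤ u s - ρ(s)`. Hence `s` minimizes `t ↦ ρ(t) - u t`, and
  -- Fermat's rule applies.
  have h1 := h (rhoDeriv ψ s) (by rw [hψ.conjugate_rhoDeriv]; exact EReal.coe_ne_top _)
  rw [hψ.conjugate_rhoDeriv, EReal.toReal_coe] at h1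
  have hmin : IsLocalMin (fun t => rho ψ t - u * t) s := Eventually.of_forall fun t => by
    have := le_toReal_conjugate hu t
    show rho ψ s - u * s ≤ rho ψ t - u * t
    linarith
  have hd : HasDerivAt (fun t => rho ψ t - u * t) (rhoDeriv ψ s - u) s := by
    simpa using (hψ.hasDerivAt_rho s).fun_sub ((hasDerivAt_id s).const_mul u)
  linarith [hmin.hasDerivAt_eq_zero hd]

lemma lowerSemicontinuous_conjugate (g : ℝ → ℝ) : LowerSemicontinuous (conjugate g) :=
  lowerSemicontinuous_iSup fun s =>
    (continuous_coe_real_ereal.comp (by fun_prop : Continuous fun u : ℝ => u * s - g s)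
      ).lowerSemicontinuous

end Rho

/-! ### Subdifferentials and the KL property -/

section General

variable {E : Type*} [NormedAddCommGroup E] [InnerProductSpace ℝ E]

lemma eventually_le_of_mem_regularSubdiff {f : E → EReal} {a v : E} {α : ℝ} (hα : f a = α)
    (hv : v ∈ regularSubdiff f a) {ε : ℝ} (hε : 0 < ε) :
    ∀ᶠ x in 𝓝 a, ((α + inner ℝ v (x - a) - ε * ‖x - a‖ : ℝ) : EReal) ≤ f x := by
  have h : ((-ε : ℝ) : EReal) < liminf (fun x : E =>
      (f x - f a - ((inner ℝ v (x - a) : ℝ) : EReal)) / ((‖x - a‖ : ℝ) : EReal)) (𝓝[≠] a) :=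
    lt_of_lt_of_le (by exact_mod_cast neg_neg_of_pos hε) hv.2
  filter_upwards [eventually_nhdsWithin_iff.1 (eventually_lt_of_lt_liminf h)] with x hx
  rcases eq_or_ne x a with rfl | hxa
  · simp [hα]
  have hpos : 0 < ‖x - a‖ := norm_pos_iff.2 (sub_ne_zero.2 hxa)
  have h1 := hx hxa
  rw [hα] at h1
  induction hfx : f x with
  | bot =>
    rw [hfx, EReal.bot_sub, EReal.bot_sub,
      EReal.bot_div_of_pos_ne_top (by exact_mod_cast hpos) (EReal.coe_ne_top _)] at h1
    exact absurd h1 not_lt_bot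
  | top => exact le_top
  | coe β =>
    rw [hfx, ← EReal.coe_sub, ← EReal.coe_sub, ← EReal.coe_div, EReal.coe_lt_coe_iff,
      lt_div_iff₀ hpos] at h1
    rw [EReal.coe_le_coe_iff]
    linarith

/-- The difference quotient is at least `-C ‖x - a‖`, which tends to 0. -/
lemma mem_regularSubdiff_of_quadratic_bound {f : E → ℝ} {a v : E} {C : ℝ}
    (h : ∀ x, f a + inner ℝ v (x - a) - C * ‖x - a‖ ^ 2 ≤ f x) :
    v ∈ regularSubdiff (fun x => (f x : EReal)) a := by
  refine ⟨EReal.coe_lt_top _, le_of_forall_lt_imp_le_of_dense fun c hc => ?_⟩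
  have ht : Tendsto (fun x : E => ((-(C * ‖x - a‖) : ℝ) : EReal)) (𝓝[≠] a) (𝓝 0) := by
    refine Tendsto.mono_left ?_ nhdsWithin_le_nhds
    have : Continuous fun x : E => ((-(C * ‖x - a‖) : ℝ) : EReal) :=
      continuous_coe_real_ereal.comp (by fun_prop)
    simpa using this.tendsto a
  refine le_liminf_of_le (by isBoundedDefault) ?_
  filter_upwards [ht.eventually_const_lt hc, self_mem_nhdsWithin] with x hx hxa
  have hpos : 0 < ‖x - a‖ := norm_pos_iff.2 (sub_ne_zero.2 hxa)
  refine hx.le.trans ?_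
  rw [← EReal.coe_sub, ← EReal.coe_sub, ← EReal.coe_div, EReal.coe_le_coe_iff, le_div_iff₀ hpos]
  nlinarith [h x]

lemma regularSubdiff_subset_limitingSubdiff (f : E → EReal) (a : E) :
    regularSubdiff f a ⊆ limitingSubdiff f a := fun v hv =>
  ⟨hv.1, fun _ => a, fun _ => v, tendsto_const_nhds, tendsto_const_nhds, fun _ => hv,
    tendsto_const_nhds⟩

/-- A closed relation that holds for regular subgradients holds for limiting subgradients. -/
lemma rel_of_mem_limitingSubdiff {f : E → EReal} {R : Set (E × E)} (hR : IsClosed R)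
    (h : ∀ a, ∀ v ∈ regularSubdiff f a, (a, v) ∈ R) {a v : E} (hv : v ∈ limitingSubdiff f a) :
    (a, v) ∈ R := by
  obtain ⟨-, x, w, hx, -, hw, hwv⟩ := hv
  exact hR.mem_of_tendsto (hx.prodMk_nhds hwv) (Eventually.of_forall fun t => h _ _ (hw t))

lemma isDesingularizing_rpow {c θ ν : ℝ} (hc : 0 < c) (hθ0 : 0 ≤ θ) (hθ1 : θ < 1) :
    IsDesingularizing (ν : EReal) (fun s => c * s ^ (1 - θ)) where
  nonneg s hs _ := by positivity
  continuousOn := fun s _ => ((Real.continuousAt_rpow_const s _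
    (Or.inr (by linarith))).const_mul c).continuousWithinAt
  concaveOn := by
    have hconv : Convex ℝ {s : ℝ | 0 ≤ s ∧ (s : EReal) < ν} := by
      simp only [EReal.coe_lt_coe_iff]
      exact convex_Ico (0 : ℝ) ν
    exact ((Real.concaveOn_rpow (by linarith) (by linarith)).smul hc.le).subset
      (fun s hs => hs.1) hconv
  contDiffOn := fun s hs => (contDiffAt_const.mul
    (Real.contDiffAt_rpow_const_of_ne hs.1.ne')).contDiffWithinAt
  deriv_pos s hs _ := by
    rw [((Real.hasDerivAt_rpow_const (Or.inl hs.ne')).const_mul c).deriv]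
    have : 0 < 1 - θ := by linarith
    positivity
  map_zero := by rw [Real.zero_rpow (by linarith), mul_zero]

lemma deriv_const_mul_rpow {c θ s : ℝ} (hs : 0 < s) :
    deriv (fun s : ℝ => c * s ^ (1 - θ)) s = c * (1 - θ) * (s ^ θ)⁻¹ := by
  rw [((Real.hasDerivAt_rpow_const (Or.inl hs.ne')).const_mul c).deriv, ← Real.rpow_neg hs.le]
  ring_nf

/-- The KL property with exponent `θ` from an error bound for subgradients. -/
lemma klPropertyExponent_of_bound {f : E → EReal} {a : E} {α θ : ℝ} (hθ0 : 0 ≤ θ) (hθ1 : θ < 1)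
    (ha : a ∈ domSubdiff f) (hα : f a = α) {κ ν : ℝ} (hκ : 0 < κ) (hν : 0 < ν)
    (h : ∀ᶠ z in 𝓝 a, ∀ w ∈ limitingSubdiff f z, ∀ β : ℝ, f z = β → α < β → β < α + ν →
      (β - α) ^ θ ≤ κ * ‖w‖) :
    KLPropertyExponent f a θ := by
  have hθ : 0 < 1 - θ := by linarith
  -- With `c = κ / (1 - θ)` the desingularizing function has derivative `κ s ^ (-θ)`.
  refine ⟨κ / (1 - θ), ν, by positivity, ha, by exact_mod_cast hν,
    isDesingularizing_rpow (by positivity) hθ0 hθ1, _, h, fun z hz h1 h2 => ?_⟩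
  rw [hα] at h1 h2 ⊢
  rw [← EReal.coe_add] at h2
  have hcoe : f z = ((f z).toReal : EReal) :=
    (EReal.coe_toReal h2.ne_top (ne_bot_of_gt h1)).symm
  generalize hβ : (f z).toReal = β at hcoe
  rw [hcoe, EReal.coe_lt_coe_iff] at h1 h2
  have hs : 0 < β - α := sub_pos.2 h1
  have hp : 0 < (β - α) ^ θ := Real.rpow_pos_of_pos hs θ
  rw [hcoe, ← EReal.coe_sub, EReal.toReal_coe, deriv_const_mul_rpow hs,
    div_mul_cancel₀ _ hθ.ne']
  have hle : ENNReal.ofReal ((β - α) ^ θ / κ) ≤ Metric.infEDist (0 : E) (limitingSubdiff f z) := by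
    refine Metric.le_infEDist.2 fun w hw => ?_
    rw [edist_dist, dist_zero_left]
    exact ENNReal.ofReal_le_ofReal ((div_le_iff₀' hκ).2 (hz w hw β hcoe h1 h2))
  calc (1 : ℝ≥0∞) = ENNReal.ofReal (κ * ((β - α) ^ θ)⁻¹) * ENNReal.ofReal ((β - α) ^ θ / κ) := by
        rw [← ENNReal.ofReal_mul (by positivity), ← ENNReal.ofReal_one]
        congr 1
        field_simp
    _ ≤ _ := by gcongr

/-- The KL property with exponent `θ` bounds all subgradients from below. -/
lemma KLPropertyExponent.exists_bound {f : E → EReal} {a : E} {α θ : ℝ} (hα : f a = α)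
    (h : KLPropertyExponent f a θ) :
    ∃ κ ν : ℝ, 0 ≤ κ ∧ 0 < ν ∧ ∀ᶠ z in 𝓝 a, ∀ w ∈ limitingSubdiff f z, ∀ β : ℝ, f z = β →
      α < β → β < α + ν → (β - α) ^ θ ≤ κ * ‖w‖ := by
  obtain ⟨c, ν, hc, -, hν, -, N, hN, hKL⟩ := h
  -- The given `ν` may be infinite; any smaller positive real serves.
  obtain ⟨ν', hν0, hν'⟩ := EReal.lt_iff_exists_real_btwn.1 hν
  refine ⟨|c * (1 - θ)|, ν', abs_nonneg _, by exact_mod_cast hν0, ?_⟩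
  filter_upwards [hN] with z hz w hw β hβ h1 h2
  have h3 := hKL z hz (by rw [hα, hβ]; exact_mod_cast h1)
    (by rw [hα, hβ]
        calc (β : EReal) < ((α + ν' : ℝ) : EReal) := by exact_mod_cast h2
          _ = α + ν' := EReal.coe_add _ _
          _ ≤ α + ν := by gcongr)
  have hs : 0 < β - α := sub_pos.2 h1
  have hp : 0 < (β - α) ^ θ := Real.rpow_pos_of_pos hs θ
  rw [hα, hβ, ← EReal.coe_sub, EReal.toReal_coe, deriv_const_mul_rpow hs] at h3
  have h4 : (1 : ℝ≥0∞) ≤ ENNReal.ofReal (c * (1 - θ) * ((β - α) ^ θ)⁻¹ * ‖w‖) := by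
    rw [ENNReal.ofReal_mul' (norm_nonneg w)]
    refine h3.trans ?_
    gcongr
    refine (Metric.infEDist_le_edist_of_mem hw).trans ?_
    rw [edist_dist, dist_zero_left]
  have h5 := ENNReal.one_le_ofReal.1 h4
  have h6 : (β - α) ^ θ ≤ c * (1 - θ) * ‖w‖ := by
    rw [mul_right_comm, ← div_eq_mul_inv, le_div_iff₀ hp, one_mul] at h5
    exact h5
  exact h6.trans (by gcongr; exact le_abs_self _)

end General

/-! ### The lifted potential -/

/-! ### Extended-real sums and indicator functions -/

lemma ereal_sum_ne_bot {ι : Type*} {s : Finset ι} {f : ι → EReal} (h : ∀ i ∈ s, f i ≠ ⊥) :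
    ∑ i ∈ s, f i ≠ ⊥ := by
  classical
  induction s using Finset.induction_on with
  | empty => simp
  | insert a s ha ih =>
    rw [Finset.sum_insert ha]
    exact EReal.add_ne_bot_iff.2 ⟨h a (Finset.mem_insert_self a s),
      ih fun i hi => h i (Finset.mem_insert_of_mem hi)⟩

lemma ereal_coe_sum {ι : Type*} (s : Finset ι) (f : ι → ℝ) :
    ((∑ i ∈ s, f i : ℝ) : EReal) = ∑ i ∈ s, (f i : EReal) := by
  classical
  induction s using Finset.induction_on with
  | empty => simp
  | insert a s ha ih => rw [Finset.sum_insert ha, Finset.sum_insert ha, EReal.coe_add, ih]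

lemma ne_top_of_ereal_sum_ne_top {ι : Type*} {s : Finset ι} {f : ι → EReal}
    (h : ∀ i ∈ s, f i ≠ ⊥) (hs : ∑ i ∈ s, f i ≠ ⊤) {i : ι} (hi : i ∈ s) : f i ≠ ⊤ := by
  classical
  intro hfi
  apply hs
  rw [← Finset.add_sum_erase s f hi, hfi]
  exact EReal.top_add_of_ne_bot (ereal_sum_ne_bot fun j hj => h j (Finset.mem_of_mem_erase hj))

lemma lowerSemicontinuous_ereal_sum {X ι : Type*} [TopologicalSpace X] {s : Finset ι}
    {f : ι → X → EReal} (hf : ∀ i ∈ s, LowerSemicontinuous (f i)) (h : ∀ i ∈ s, ∀ x, f i x ≠ ⊥) :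
    LowerSemicontinuous fun x => ∑ i ∈ s, f i x := by
  classical
  induction s using Finset.induction_on with
  | empty => simpa using! (lowerSemicontinuous_const (z := (0 : EReal)) (α := X))
  | insert a s ha ih =>
    simp only [Finset.sum_insert ha]
    refine (hf a (Finset.mem_insert_self a s)).add'
      (ih (fun i hi => hf i (Finset.mem_insert_of_mem hi))
        fun i hi => h i (Finset.mem_insert_of_mem hi)) fun x => ?_
    exact EReal.continuousAt_add
      (Or.inr (ereal_sum_ne_bot fun i hi => h i (Finset.mem_insert_of_mem hi) x))
      (Or.inl (h a (Finset.mem_insert_self a s) x))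

lemma indicatorFn_of_mem {E : Type*} {D : Set E} {x : E} (h : x ∈ D) : indicatorFn D x = 0 :=
  if_pos h

lemma indicatorFn_of_notMem {E : Type*} {D : Set E} {x : E} (h : x ∉ D) : indicatorFn D x = ⊤ :=
  if_neg h

lemma indicatorFn_ne_bot {E : Type*} (D : Set E) (x : E) : indicatorFn D x ≠ ⊥ := by
  by_cases h : x ∈ D
  · simp [indicatorFn_of_mem h]
  · simp [indicatorFn_of_notMem h]

lemma lowerSemicontinuous_indicatorFn {E : Type*} [TopologicalSpace E] {D : Set E}
    (hD : IsClosed D) : LowerSemicontinuous (indicatorFn D) := by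
  intro x y hy
  by_cases h : x ∈ D
  · rw [indicatorFn_of_mem h] at hy
    refine Eventually.of_forall fun x' => ?_
    show y < indicatorFn D x'
    by_cases h' : x' ∈ D
    · rwa [indicatorFn_of_mem h']
    · rw [indicatorFn_of_notMem h']
      exact hy.trans_le le_top
  · rw [indicatorFn_of_notMem h] at hy
    filter_upwards [hD.isOpen_compl.mem_nhds h] with x' hx'
    show y < indicatorFn D x'
    rwa [indicatorFn_of_notMem hx']

section Lift

variable {n m : ℕ} {D : Fin m → Set (EuclideanSpace ℝ (Fin n))} {ψ : ℝ → ℝ}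

/-- The finite values of the lifted potential. -/
noncomputable def liftReal (ψ : ℝ → ℝ) (z : LiftSpace n m) : ℝ :=
  ∑ i, ((conjugate (rho ψ) (z.snd.snd i)).toReal - z.snd.snd i * ‖z.fst - z.snd.fst i‖ ^ 2)

/-- The domain of the lifted potential. -/
def LiftDom (ψ : ℝ → ℝ) (D : Fin m → Set (EuclideanSpace ℝ (Fin n))) (z : LiftSpace n m) : Prop :=
  ∀ i, z.snd.fst i ∈ D i ∧ conjugate (rho ψ) (z.snd.snd i) ≠ ⊤

lemma summand_ne_bot (ψ : ℝ → ℝ) (D : Fin m → Set (EuclideanSpace ℝ (Fin n)))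
    (z : LiftSpace n m) (i : Fin m) :
    conjugate (rho ψ) (z.snd.snd i) + ((-(z.snd.snd i * ‖z.fst - z.snd.fst i‖ ^ 2) : ℝ) : EReal)
      + indicatorFn (D i) (z.snd.fst i) ≠ ⊥ :=
  EReal.add_ne_bot_iff.2 ⟨EReal.add_ne_bot_iff.2 ⟨conjugate_ne_bot _ _, EReal.coe_ne_bot _⟩,
    indicatorFn_ne_bot _ _⟩

lemma LiftDom.liftedPotential_eq {z : LiftSpace n m} (hz : LiftDom ψ D z) :
    liftedPotential ψ D z = liftReal ψ z := by
  have : ∀ i ∈ Finset.univ, conjugate (rho ψ) (z.snd.snd i) +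
      ((-(z.snd.snd i * ‖z.fst - z.snd.fst i‖ ^ 2) : ℝ) : EReal)
      + indicatorFn (D i) (z.snd.fst i) =
      (((conjugate (rho ψ) (z.snd.snd i)).toReal -
        z.snd.snd i * ‖z.fst - z.snd.fst i‖ ^ 2 : ℝ) : EReal) := fun i _ => by
    rw [indicatorFn_of_mem (hz i).1, add_zero, sub_eq_add_neg (conjugate _ _).toReal, EReal.coe_add,
      EReal.coe_toReal (hz i).2 (conjugate_ne_bot _ _)]
  exact (Finset.sum_congr rfl this).trans (ereal_coe_sum _ _).symm

lemma liftDom_of_ne_top {z : LiftSpace n m} (hz : liftedPotential ψ D z ≠ ⊤) :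
    LiftDom ψ D z := fun i => by
  have h := ne_top_of_ereal_sum_ne_top (fun i _ => summand_ne_bot ψ D z i) hz (Finset.mem_univ i)
  constructor
  · by_contra hi
    rw [indicatorFn_of_notMem hi] at h
    exact h (EReal.add_top_of_ne_bot
      (EReal.add_ne_bot_iff.2 ⟨conjugate_ne_bot _ _, EReal.coe_ne_bot _⟩))
  · intro hi
    rw [hi, EReal.top_add_coe] at h
    exact h (EReal.top_add_of_ne_bot (indicatorFn_ne_bot _ _))

lemma continuous_lift_base : Continuous fun z : LiftSpace n m => z.fst := by fun_prop

lemma continuous_lift_point (i : Fin m) : Continuous fun z : LiftSpace n m => z.snd.fst i := by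
  fun_prop

lemma continuous_lift_weight (i : Fin m) : Continuous fun z : LiftSpace n m => z.snd.snd i := by
  fun_prop

lemma lowerSemicontinuous_liftedPotential (hD : ∀ i, IsClosed (D i)) :
    LowerSemicontinuous fun z : LiftSpace n m => liftedPotential ψ D z := by
  refine lowerSemicontinuous_ereal_sum (fun i _ => ?_) fun i _ z => summand_ne_bot ψ D z i
  have h1 : LowerSemicontinuous fun z : LiftSpace n m => conjugate (rho ψ) (z.snd.snd i) :=
    (lowerSemicontinuous_conjugate (rho ψ)).comp (continuous_lift_weight i)
  have h2 : Continuous fun z : LiftSpace n m =>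
      ((-(z.snd.snd i * ‖z.fst - z.snd.fst i‖ ^ 2) : ℝ) : EReal) :=
    continuous_coe_real_ereal.comp (by fun_prop)
  have h3 : LowerSemicontinuous fun z : LiftSpace n m => indicatorFn (D i) (z.snd.fst i) :=
    (lowerSemicontinuous_indicatorFn (hD i)).comp (continuous_lift_point i)
  refine (h1.add' h2.lowerSemicontinuous fun z => ?_).add' h3 fun z => ?_
  · exact EReal.continuousAt_add (Or.inr (EReal.coe_ne_bot _)) (Or.inr (EReal.coe_ne_top _))
  · exact EReal.continuousAt_add (Or.inr (indicatorFn_ne_bot _ _))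
      (Or.inl (EReal.add_ne_bot_iff.2 ⟨conjugate_ne_bot _ _, EReal.coe_ne_bot _⟩))

/-- The point of the lifted space with given components. -/
def liftPoint (x : EuclideanSpace ℝ (Fin n)) (ξ : Fin m → EuclideanSpace ℝ (Fin n))
    (u : Fin m → ℝ) : LiftSpace n m :=
  WithLp.toLp 2 (x, WithLp.toLp 2 (WithLp.toLp 2 ξ, WithLp.toLp 2 u))

lemma isProper_liftedPotential (hψ : MemTheta ψ) (hD : ∀ i, (D i).Nonempty) :
    IsProper fun z : LiftSpace n m => liftedPotential ψ D z := by
  refine ⟨?_, fun z => ereal_sum_ne_bot fun i _ => summand_ne_bot ψ D z i⟩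
  choose ξ hξ using hD
  have : LiftDom ψ D (liftPoint 0 ξ fun _ => rhoDeriv ψ 0) := fun i =>
    ⟨hξ i, by
      show conjugate (rho ψ) (rhoDeriv ψ 0) ≠ ⊤
      rw [hψ.conjugate_rhoDeriv]
      exact EReal.coe_ne_top _⟩
  exact ⟨_, this.liftedPotential_eq ▸ EReal.coe_lt_top _⟩

/-! ### Subgradients of the lifted potential -/

lemma inner_lift (w z : LiftSpace n m) :
    inner ℝ w z = inner ℝ w.fst z.fst + (∑ i, inner ℝ (w.snd.fst i) (z.snd.fst i) +
      ∑ i, w.snd.snd i * z.snd.snd i) := by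
  simp only [WithLp.prod_inner_apply, PiLp.inner_apply]
  congr 2
  refine Finset.sum_congr rfl fun i _ => ?_
  simp [mul_comm]

lemma norm_lift_base_le (w : LiftSpace n m) : ‖w.fst‖ ≤ ‖w‖ := WithLp.norm_fst_le _ w

lemma norm_lift_point_le (w : LiftSpace n m) (i : Fin m) : ‖w.snd.fst i‖ ≤ ‖w‖ :=
  ((PiLp.norm_apply_le _ i).trans (WithLp.norm_fst_le _ _)).trans (WithLp.norm_snd_le _ w)

lemma abs_lift_weight_le (w : LiftSpace n m) (i : Fin m) : |w.snd.snd i| ≤ ‖w‖ :=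
  ((PiLp.norm_apply_le w.snd.snd i).trans (WithLp.norm_snd_le _ _)).trans (WithLp.norm_snd_le _ w)

/-- An upper bound of first order along a ray bounds regular subgradients in its direction. -/
lemma inner_le_of_mem_regularSubdiff {E : Type*} [NormedAddCommGroup E] [InnerProductSpace ℝ E]
    {f : E → EReal} {a v h : E} {α A B : ℝ} (hα : f a = α) (hv : v ∈ regularSubdiff f a)
    (hray : ∀ t : ℝ, 0 < t → t ≤ 1 → f (a + t • h) ≤ ((α + t * A + t ^ 2 * B : ℝ) : EReal)) :
    inner ℝ v h ≤ A := by
  have key (ε : ℝ) (hε : 0 < ε) : inner ℝ v h - ε * ‖h‖ ≤ A := by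
    have hlim : Tendsto (fun t : ℝ => a + t • h) (𝓝[>] 0) (𝓝 a) := by
      have : Continuous fun t : ℝ => a + t • h := by fun_prop
      simpa using (this.tendsto 0).mono_left nhdsWithin_le_nhds
    have hlimB : Tendsto (fun t : ℝ => A + t * B) (𝓝[>] 0) (𝓝 A) := by
      have : Continuous fun t : ℝ => A + t * B := by fun_prop
      simpa using (this.tendsto 0).mono_left nhdsWithin_le_nhds
    refine ge_of_tendsto hlimB ?_
    filter_upwards [hlim.eventually (eventually_le_of_mem_regularSubdiff hα hv hε),
      Ioc_mem_nhdsGT (zero_lt_one' ℝ)] with t ht ht01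
    have h1 := EReal.coe_le_coe_iff.1 (ht.trans (hray t ht01.1 ht01.2))
    rw [add_sub_cancel_left, inner_smul_right, norm_smul, Real.norm_of_nonneg ht01.1.le] at h1
    nlinarith [ht01.1]
  refine le_of_forall_pos_le_add fun ε hε => ?_
  have h1 := key (ε / (‖h‖ + 1)) (by positivity)
  have h2 : ε / (‖h‖ + 1) * ‖h‖ ≤ ε := by
    rw [div_mul_eq_mul_div, div_le_iff₀ (by positivity)]
    nlinarith [norm_nonneg h]
  linarith

/-- The domain of `F` is convex, so the segment from `z` to `y` stays in it. Along it `ρ*` lies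
below its chord and the other term is a cubic polynomial in `t`; the right-hand side is the
resulting coefficient of `t`. -/
lemma regular_lift_inequality (hD : ∀ i, Convex ℝ (D i)) {z w : LiftSpace n m}
    (hw : w ∈ regularSubdiff (fun z : LiftSpace n m => liftedPotential ψ D z) z)
    (hz : LiftDom ψ D z) {y : LiftSpace n m} (hy : LiftDom ψ D y) :
    inner ℝ w (y - z) ≤ ∑ i, ((conjugate (rho ψ) (y.snd.snd i)).toReal -
      (conjugate (rho ψ) (z.snd.snd i)).toReal
      - (y.snd.snd i - z.snd.snd i) * ‖z.fst - z.snd.fst i‖ ^ 2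
      - 2 * z.snd.snd i * inner ℝ (z.fst - z.snd.fst i)
        ((y.fst - z.fst) - (y.snd.fst i - z.snd.fst i))) := by
  -- The first two terms are the coefficient of `t ^ 2`; the last one absorbs the cubic term, as `t
  -- ≤ 1`.
  set B : ℝ := ∑ i, (-2 * (y.snd.snd i - z.snd.snd i) * inner ℝ (z.fst - z.snd.fst i)
        ((y.fst - z.fst) - (y.snd.fst i - z.snd.fst i))
      - z.snd.snd i * ‖(y.fst - z.fst) - (y.snd.fst i - z.snd.fst i)‖ ^ 2
      + |y.snd.snd i - z.snd.snd i| * ‖(y.fst - z.fst) - (y.snd.fst i - z.snd.fst i)‖ ^ 2)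
  refine inner_le_of_mem_regularSubdiff (B := B) hz.liftedPotential_eq hw fun t h0 h1 => ?_
  have hc i := conjugate_convex_comb (hz i).2 (hy i).2 h0.le h1
  have hdom : LiftDom ψ D (z + t • (y - z)) := fun i =>
    ⟨(hD i).add_smul_sub_mem (hz i).1 (hy i).1 ⟨h0.le, h1⟩, (hc i).1⟩
  rw [hdom.liftedPotential_eq, EReal.coe_le_coe_iff]
  unfold liftReal
  rw [Finset.mul_sum, Finset.mul_sum, ← Finset.sum_add_distrib, ← Finset.sum_add_distrib]
  refine Finset.sum_le_sum fun i _ => ?_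
  have e1 : (z + t • (y - z)).snd.snd i = z.snd.snd i + t * (y.snd.snd i - z.snd.snd i) := rfl
  have e2 : (z + t • (y - z)).fst - (z + t • (y - z)).snd.fst i = (z.fst - z.snd.fst i) +
      t • ((y.fst - z.fst) - (y.snd.fst i - z.snd.fst i)) := by
    show (z.fst + t • (y.fst - z.fst)) - (z.snd.fst i + t • (y.snd.fst i - z.snd.fst i)) = _
    module
  rw [e1, e2, norm_add_sq_real, inner_smul_right, norm_smul, Real.norm_of_nonneg h0.le]
  have h2 := (hc i).2
  set a := z.fst - z.snd.fst i
  set b := (y.fst - z.fst) - (y.snd.fst i - z.snd.fst i)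
  set δ := y.snd.snd i - z.snd.snd i
  have h3 : -(t * δ) ≤ |δ| := by
    calc -(t * δ) ≤ |t * δ| := neg_le_abs _
      _ = t * |δ| := by rw [abs_mul, abs_of_pos h0]
      _ ≤ 1 * |δ| := by gcongr
      _ = |δ| := one_mul _
  have h4 : 0 ≤ (t * δ + |δ|) * (t ^ 2 * ‖b‖ ^ 2) := by
    have : 0 ≤ t * δ + |δ| := by linarith
    positivity
  nlinarith

/-- The relation between points and limiting subgradients of the lifted potential. -/
structure LiftSubgradient (ψ : ℝ → ℝ) (D : Fin m → Set (EuclideanSpace ℝ (Fin n)))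
    (z w : LiftSpace n m) : Prop where
  mem : ∀ i, z.snd.fst i ∈ D i
  weight : ∀ i, z.snd.snd i = rhoDeriv ψ (w.snd.snd i + ‖z.fst - z.snd.fst i‖ ^ 2)
  point : ∀ i, ∀ y ∈ D i, inner ℝ (w.snd.fst i - (2 * z.snd.snd i) • (z.fst - z.snd.fst i))
    (y - z.snd.fst i) ≤ 0
  base : w.fst = ∑ i, (-2 * z.snd.snd i) • (z.fst - z.snd.fst i)

/-- The subgradient condition for `ρ*` is written in inverted form, through the continuous `ρ'`, and
the normal cone condition as one inequality for each fixed `y`. Each condition is therefore closed,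
and limits need no convergence of the values of `F`. -/
lemma isClosed_liftSubgradient (hψ : MemTheta ψ) (hD : ∀ i, IsClosed (D i)) :
    IsClosed {p : LiftSpace n m × LiftSpace n m | LiftSubgradient ψ D p.1 p.2} := by
  have hr := hψ.continuous_rhoDeriv
  have h1 : IsClosed {p : LiftSpace n m × LiftSpace n m | ∀ i, p.1.snd.fst i ∈ D i} := by
    simp only [ofPred_forall]
    exact isClosed_iInter fun i => (hD i).preimage (by fun_prop)
  have h2 : IsClosed {p : LiftSpace n m × LiftSpace n m | ∀ i,
      p.1.snd.snd i = rhoDeriv ψ (p.2.snd.snd i + ‖p.1.fst - p.1.snd.fst i‖ ^ 2)} := by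
    simp only [ofPred_forall]
    exact isClosed_iInter fun i => isClosed_eq (by fun_prop) (by fun_prop)
  have h3 : IsClosed {p : LiftSpace n m × LiftSpace n m | ∀ i, ∀ y ∈ D i,
      inner ℝ (p.2.snd.fst i - (2 * p.1.snd.snd i) • (p.1.fst - p.1.snd.fst i))
        (y - p.1.snd.fst i) ≤ 0} := by
    simp only [ofPred_forall]
    exact isClosed_iInter fun i => isClosed_iInter fun y => isClosed_iInter fun _ =>
      isClosed_le (by fun_prop) continuous_const
  have h4 : IsClosed {p : LiftSpace n m × LiftSpace n m |
      p.2.fst = ∑ i, (-2 * p.1.snd.snd i) • (p.1.fst - p.1.snd.fst i)} :=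
    isClosed_eq (by fun_prop) (by fun_prop)
  convert ((h1.inter h2).inter h3).inter h4 using 1
  ext p
  exact ⟨fun h => ⟨⟨⟨h.1, h.2⟩, h.3⟩, h.4⟩, fun h => ⟨h.1.1.1, h.1.1.2, h.1.2, h.2⟩⟩

/-- Each condition comes from the inequality of `regular_lift_inequality` by moving a single block:
one weight, one point, or the base. -/
lemma liftSubgradient_of_mem_regularSubdiff (hψ : MemTheta ψ) (hD : ∀ i, Convex ℝ (D i))
    {z w : LiftSpace n m}
    (hw : w ∈ regularSubdiff (fun z : LiftSpace n m => liftedPotential ψ D z) z) :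
    LiftSubgradient ψ D z w := by
  classical
  have hz : LiftDom ψ D z := liftDom_of_ne_top hw.1.ne
  have key (x : EuclideanSpace ℝ (Fin n)) (ξ : Fin m → EuclideanSpace ℝ (Fin n)) (u : Fin m → ℝ)
      (hξ : ∀ i, ξ i ∈ D i) (hu : ∀ i, conjugate (rho ψ) (u i) ≠ ⊤) :
      inner ℝ w.fst (x - z.fst) + (∑ i, inner ℝ (w.snd.fst i) (ξ i - z.snd.fst i) +
        ∑ i, w.snd.snd i * (u i - z.snd.snd i)) ≤
      ∑ i, ((conjugate (rho ψ) (u i)).toReal - (conjugate (rho ψ) (z.snd.snd i)).toReal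
        - (u i - z.snd.snd i) * ‖z.fst - z.snd.fst i‖ ^ 2
        - 2 * z.snd.snd i * inner ℝ (z.fst - z.snd.fst i)
          ((x - z.fst) - (ξ i - z.snd.fst i))) := by
    have h := regular_lift_inequality hD hw hz (y := liftPoint x ξ u) fun i => ⟨hξ i, hu i⟩
    rwa [inner_lift] at h
  refine ⟨fun i => (hz i).1, fun j => ?_, fun j y hy => ?_, ?_⟩
  · refine hψ.eq_rhoDeriv_of_subgradient (hz j).2 fun v hv => ?_
    have h := key z.fst (fun i => z.snd.fst i) (Function.update (fun i => z.snd.snd i) j v)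
      (fun i => (hz i).1) fun i => by
        rcases eq_or_ne i j with rfl | hi
        · simpa using hv
        · simpa [Function.update_of_ne hi] using (hz i).2
    rw [Finset.sum_eq_single (M := ℝ) (s := Finset.univ)
        (f := fun i => w.snd.snd i * (_ - z.snd.snd i)) j
        (fun i _ hi => by simp [Function.update_of_ne hi]) (by simp),
      Finset.sum_eq_single (M := ℝ) (s := Finset.univ) (f := fun i => _ - _ - _ - _) j
        (fun i _ hi => by simp [Function.update_of_ne hi]) (by simp)] at h
    simp only [sub_self, inner_zero_right, Finset.sum_const_zero, Function.update_self,
      mul_zero, zero_add, sub_zero] at h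
    linarith
  · have h := key z.fst (Function.update (fun i => z.snd.fst i) j y) (fun i => z.snd.snd i)
      (fun i => by
        rcases eq_or_ne i j with rfl | hi
        · simpa using hy
        · simpa [Function.update_of_ne hi] using (hz i).1) fun i => (hz i).2
    rw [Finset.sum_eq_single (M := ℝ) (s := Finset.univ)
        (f := fun i => inner ℝ (w.snd.fst i) (_ - z.snd.fst i)) j
        (fun i _ hi => by simp [Function.update_of_ne hi]) (by simp),
      Finset.sum_eq_single (M := ℝ) (s := Finset.univ) (f := fun i => _ - _ - _ - _) j
        (fun i _ hi => by simp [Function.update_of_ne hi]) (by simp)] at h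
    simp only [sub_self, inner_zero_right, Finset.sum_const_zero, Function.update_self,
      mul_zero, zero_mul, zero_add, add_zero, zero_sub, inner_neg_right] at h
    rw [inner_sub_left, inner_smul_left]
    simp only [conj_trivial]
    linarith
  · set g := ∑ i, (-2 * z.snd.snd i) • (z.fst - z.snd.fst i)
    -- Moving the base in the direction `w.fst - g` yields `‖w.fst - g‖ ^ 2 ≤ 0`.
    have h := key (z.fst + (w.fst - g)) (fun i => z.snd.fst i) (fun i => z.snd.snd i)
      (fun i => (hz i).1) fun i => (hz i).2
    have hg : inner ℝ g (w.fst - g) = ∑ i, -(2 * z.snd.snd i *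
        inner ℝ (z.fst - z.snd.fst i) (w.fst - g)) := by
      rw [sum_inner]
      refine Finset.sum_congr rfl fun i _ => ?_
      rw [inner_smul_left]
      simp
    simp only [sub_self, inner_zero_right, Finset.sum_const_zero, mul_zero, zero_mul, add_zero,
      zero_sub, add_sub_cancel_left, sub_zero] at h
    rw [← hg, ← sub_nonpos, ← inner_sub_left, real_inner_self_eq_norm_sq] at h
    exact sub_eq_zero.1 (norm_eq_zero.1 (pow_eq_zero_iff two_ne_zero |>.1
      (le_antisymm h (sq_nonneg _))))

lemma liftSubgradient_of_mem_limitingSubdiff (hψ : MemTheta ψ) (hDc : ∀ i, IsClosed (D i))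
    (hD : ∀ i, Convex ℝ (D i)) {z w : LiftSpace n m}
    (hw : w ∈ limitingSubdiff (fun z : LiftSpace n m => liftedPotential ψ D z) z) :
    LiftSubgradient ψ D z w :=
  rel_of_mem_limitingSubdiff (isClosed_liftSubgradient hψ hDc)
    (fun _ _ h => liftSubgradient_of_mem_regularSubdiff hψ hD h) hw

lemma LiftSubgradient.liftDom (hψ : MemTheta ψ) {z w : LiftSpace n m}
    (h : LiftSubgradient ψ D z w) : LiftDom ψ D z := fun i =>
  ⟨h.mem i, by rw [h.weight i, hψ.conjugate_rhoDeriv]; exact EReal.coe_ne_top _⟩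

end Lift

/-! ### Projections and error bounds -/

section Projection

variable {E : Type*} [NormedAddCommGroup E] [InnerProductSpace ℝ E]

/-- The point `p` is the projection of `x` onto `D`. -/
structure IsProjection (D : Set E) (x p : E) : Prop where
  mem : p ∈ D
  infDist_eq : Metric.infDist x D = ‖x - p‖
  inner_le : ∀ y ∈ D, inner ℝ (x - p) (y - p) ≤ 0

lemma exists_isProjection [ProperSpace E] {D : Set E} (h0 : D.Nonempty) (hc : IsClosed D)
    (hD : Convex ℝ D) (x : E) : ∃ p, IsProjection D x p := by
  obtain ⟨p, hp, hd⟩ := hc.exists_infDist_eq_dist h0 x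
  rw [dist_eq_norm] at hd
  refine ⟨p, hp, hd, (norm_eq_iInf_iff_real_inner_le_zero hD hp).1 ?_⟩
  rw [← hd, Metric.infDist_eq_iInf]
  simp only [dist_eq_norm]

/-- An affine minorant of the squared distance: expand `y - q` around `x - p`, drop a square and use
the obtuse angle at `p`. -/
lemma IsProjection.sq_add_inner_le {D : Set E} {x p y q : E} (hp : IsProjection D x p)
    (hq : q ∈ D) : ‖x - p‖ ^ 2 + 2 * inner ℝ (x - p) (y - x) ≤ ‖y - q‖ ^ 2 := by
  have h1 := hp.inner_le q hq
  have h2 : y - q = (x - p) + ((y - x) - (q - p)) := by abel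
  have h3 : 0 ≤ ‖(y - x) - (q - p)‖ ^ 2 := sq_nonneg _
  rw [h2, norm_add_sq_real, inner_sub_right (x - p) (y - x)]
  linarith

/-- Error bounds for an approximate projection. -/
lemma IsProjection.approx {D : Set E} {x p ξ w : E} {u q W : ℝ} (hp : IsProjection D x p)
    (hξ : ξ ∈ D) (hw : ∀ y ∈ D, inner ℝ (w - (2 * u) • (x - ξ)) (y - ξ) ≤ 0) (hq : 0 < q)
    (hu : 1 ≤ q * (-2 * u)) (hW : ‖w‖ ≤ W) :
    ‖ξ - p‖ ≤ q * W ∧ 0 ≤ ‖x - ξ‖ ^ 2 - ‖x - p‖ ^ 2 ∧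
      ‖x - ξ‖ ^ 2 - ‖x - p‖ ^ 2 ≤ (q * W) ^ 2 := by
  have hW0 : 0 ≤ W := (norm_nonneg _).trans hW
  set e := p - ξ
  set a := x - ξ
  have hae : x - p = a - e := by simp [a, e]
  -- The variational inequality at `p` is tested with `ξ`, and the one at `ξ` with `p`. Together
  -- they give `‖e‖ ^ 2 ≤ ⟨a, e⟩ ≤ q W ‖e‖`.
  have h1 : ‖e‖ ^ 2 ≤ inner ℝ a e := by
    have h := hp.inner_le ξ hξ
    have : ξ - p = -e := by simp [e]
    rw [hae, this, inner_neg_right, inner_sub_left, real_inner_self_eq_norm_sq] at h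
    linarith
  have h2 : (-2 * u) * inner ℝ a e ≤ W * ‖e‖ := by
    have h := hw p hp.mem
    rw [inner_sub_left, inner_smul_left] at h
    simp only [conj_trivial] at h
    have h' : -(W * ‖e‖) ≤ inner ℝ w e := by
      have h3 := abs_real_inner_le_norm w e
      have h4 : ‖w‖ * ‖e‖ ≤ W * ‖e‖ := by gcongr
      linarith [neg_abs_le (inner ℝ w e : ℝ)]
    linarith
  have h0 : (0 : ℝ) ≤ inner ℝ a e := (sq_nonneg _).trans h1
  have h3 : inner ℝ a e ≤ q * W * ‖e‖ :=
    calc inner ℝ a e ≤ (q * (-2 * u)) * inner ℝ a e := le_mul_of_one_le_left h0 hu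
      _ = q * ((-2 * u) * inner ℝ a e) := by ring
      _ ≤ q * (W * ‖e‖) := by gcongr
      _ = q * W * ‖e‖ := by ring
  have h4 : ‖e‖ ≤ q * W := by
    rcases (norm_nonneg e).eq_or_lt with he | he
    · rw [← he]
      positivity
    · exact le_of_mul_le_mul_right (by nlinarith) he
  have hsq : ‖x - p‖ ^ 2 = ‖a‖ ^ 2 - 2 * inner ℝ a e + ‖e‖ ^ 2 := by
    rw [hae, norm_sub_sq_real]
  refine ⟨?_, ?_, ?_⟩
  · rwa [norm_sub_rev]
  · nlinarith [sq_nonneg ‖e‖]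
  -- The difference of squares is `2 ⟨a, e⟩ - ‖e‖ ^ 2 ≤ 2 q W ‖e‖ - ‖e‖ ^ 2 ≤ (q W) ^ 2`.
  · nlinarith [sq_nonneg (q * W - ‖e‖)]

end Projection

/-! ### Comparison of the lifted potential with `Ψ` -/

section Estimates

variable {n m : ℕ} {D : Fin m → Set (EuclideanSpace ℝ (Fin n))} {ψ : ℝ → ℝ}

/-- The gradient of `Ψ` at `x`, in terms of the projections of `x`. -/
noncomputable def gradPsi (ψ : ℝ → ℝ) (x : EuclideanSpace ℝ (Fin n))
    (p : Fin m → EuclideanSpace ℝ (Fin n)) : EuclideanSpace ℝ (Fin n) :=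
  ∑ i, (-2 * rhoDeriv ψ (‖x - p i‖ ^ 2)) • (x - p i)

lemma psi_infDist_sq {E : Type*} [NormedAddCommGroup E] [InnerProductSpace ℝ E] {D : Set E}
    {x p : E} (hp : IsProjection D x p) :
    ψ (Metric.infDist x D ^ 2) = -rho ψ (‖x - p‖ ^ 2) := by
  rw [hp.infDist_eq, rho_of_nonneg (sq_nonneg _), neg_neg]

/-- The increasing function `-ρ` is applied to the affine minorant of the squared distance, and the
descent lemma for ρ leaves a quadratic error. The minorant may be negative, where the extension of ρ
to the whole line is needed. -/
lemma gradPsi_mem_regularSubdiff (hψ : MemTheta ψ) (h0 : ∀ i, (D i).Nonempty)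
    (hc : ∀ i, IsClosed (D i)) (hD : ∀ i, Convex ℝ (D i)) {x : EuclideanSpace ℝ (Fin n)}
    {p : Fin m → EuclideanSpace ℝ (Fin n)} (hp : ∀ i, IsProjection (D i) x (p i)) :
    gradPsi ψ x p ∈
      regularSubdiff (fun x : EuclideanSpace ℝ (Fin n) => (Psi ψ D x : EReal)) x := by
  obtain ⟨L, hL0, hL⟩ := hψ.exists_rhoDeriv_lipschitz
  refine mem_regularSubdiff_of_quadratic_bound (C := ∑ i, 4 * L * ‖x - p i‖ ^ 2) fun y => ?_
  unfold gradPsi Psi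
  rw [sum_inner, Finset.sum_mul, ← Finset.sum_add_distrib, ← Finset.sum_sub_distrib]
  refine Finset.sum_le_sum fun i _ => ?_
  obtain ⟨q, hq⟩ := exists_isProjection (h0 i) (hc i) (hD i) y
  rw [psi_infDist_sq (ψ := ψ) (hp i), psi_infDist_sq (ψ := ψ) hq, inner_smul_left]
  simp only [conj_trivial]
  have h1 := hψ.rho_antitone ((hp i).sq_add_inner_le (y := y) hq.mem)
  have h2 := hψ.rho_sub_tangent_le hL0 hL (‖x - p i‖ ^ 2)
    (‖x - p i‖ ^ 2 + 2 * inner ℝ (x - p i) (y - x))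
  rw [add_sub_cancel_left] at h2
  have h3 : L * (2 * inner ℝ (x - p i) (y - x)) ^ 2 ≤ 4 * L * ‖x - p i‖ ^ 2 * ‖y - x‖ ^ 2 := by
    have h4 := sq_le_sq' (neg_le_of_abs_le (abs_real_inner_le_norm (x - p i) (y - x)))
      (le_of_abs_le (abs_real_inner_le_norm (x - p i) (y - x)))
    nlinarith
  linarith

lemma Psi_le_liftReal (hψ : MemTheta ψ) (h0 : ∀ i, (D i).Nonempty)
    (hc : ∀ i, IsClosed (D i)) (hD : ∀ i, Convex ℝ (D i)) {z : LiftSpace n m}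
    (hz : LiftDom ψ D z) : Psi ψ D z.fst ≤ liftReal ψ z := by
  refine Finset.sum_le_sum fun i _ => ?_
  obtain ⟨p, hp⟩ := exists_isProjection (h0 i) (hc i) (hD i) z.fst
  rw [psi_infDist_sq (ψ := ψ) hp]
  have h1 : ‖z.fst - p‖ ^ 2 ≤ ‖z.fst - z.snd.fst i‖ ^ 2 := by
    simpa using hp.sq_add_inner_le (y := z.fst) (hz i).1
  have h2 := le_toReal_conjugate (hz i).2 (‖z.fst - z.snd.fst i‖ ^ 2)
  linarith [hψ.rho_antitone h1]

/-- Near a point at which zero is a subgradient of the lifted potential, subgradients of the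
lifted potential control both its distance to `Ψ` and the gradient of `Ψ`. -/
lemma exists_error_bound (hψ : MemTheta ψ) (h0 : ∀ i, (D i).Nonempty)
    (hc : ∀ i, IsClosed (D i)) (hD : ∀ i, Convex ℝ (D i)) {a : LiftSpace n m}
    (ha : LiftSubgradient ψ D a 0) :
    ∃ C : ℝ, 0 ≤ C ∧ ∀ᶠ z in 𝓝 a, ∀ w, LiftSubgradient ψ D z w →
      liftReal ψ z - Psi ψ D z.fst ≤ C * ‖w‖ ^ 2 ∧
      (‖w‖ ≤ 1 → ∃ g ∈ regularSubdiff
        (fun x : EuclideanSpace ℝ (Fin n) => (Psi ψ D x : EReal)) z.fst, ‖g‖ ≤ C * ‖w‖) := by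
  obtain ⟨L, hL0, hL⟩ := hψ.exists_rhoDeriv_lipschitz
  have hneg i : a.snd.snd i < 0 := by rw [ha.weight i]; exact hψ.rhoDeriv_neg _
  -- Near `a` each weight is below half its negative value at `a`, so `-2 * z.snd.snd i ≥ 1 / q i`.
  set q : Fin m → ℝ := fun i => (-a.snd.snd i)⁻¹ with hq
  have hq0 i : 0 < q i := inv_pos.2 (neg_pos.2 (hneg i))
  set R : Fin m → ℝ := fun i => ‖a.fst - a.snd.fst i‖ + 1
  have hR0 i : 0 ≤ R i := by positivity
  set l : ℝ := -rhoDeriv ψ 0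
  have hl0 : 0 ≤ l := neg_nonneg.2 (hψ.rhoDeriv_neg 0).le
  have hl {σ : ℝ} (hσ : 0 ≤ σ) : -rhoDeriv ψ σ ≤ l := neg_le_neg (hψ.rhoDeriv_monotone hσ)
  set C₁ : ℝ := ∑ i, (L + l * q i ^ 2)
  set C₂ : ℝ := 1 + ∑ i, (2 * (L * (1 + q i ^ 2)) * R i + 2 * l * q i)
  have hC₁ : 0 ≤ C₁ := Finset.sum_nonneg fun i _ => by positivity
  have hC₂ : 0 ≤ C₂ := add_nonneg zero_le_one (Finset.sum_nonneg fun i _ => by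
    have := hq0 i
    have := hR0 i
    positivity)
  refine ⟨C₁ + C₂, add_nonneg hC₁ hC₂, ?_⟩
  have hev1 : ∀ᶠ z : LiftSpace n m in 𝓝 a, ∀ i, z.snd.snd i < a.snd.snd i / 2 :=
    eventually_all.2 fun i => (continuous_lift_weight i).tendsto a |>.eventually_lt_const
      (by linarith [hneg i])
  have hev2 : ∀ᶠ z : LiftSpace n m in 𝓝 a, ∀ i, ‖z.fst - z.snd.fst i‖ < R i :=
    eventually_all.2 fun i =>
      (by fun_prop : Continuous fun z : LiftSpace n m => ‖z.fst - z.snd.fst i‖).tendsto a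
        |>.eventually_lt_const (lt_add_one _)
  filter_upwards [hev1, hev2] with z hz1 hz2 w hw
  choose p hp using fun i => exists_isProjection (h0 i) (hc i) (hD i) z.fst
  have happ i := (hp i).approx (hw.mem i) (hw.point i) (hq0 i)
    (by
      have h1 : q i * -a.snd.snd i = 1 := inv_mul_cancel₀ (neg_pos.2 (hneg i)).ne'
      have h2 : q i * -a.snd.snd i ≤ q i * (-2 * z.snd.snd i) :=
        mul_le_mul_of_nonneg_left (by linarith [hz1 i]) (hq0 i).le
      linarith) (norm_lift_point_le w i)
  have hW : 0 ≤ ‖w‖ := norm_nonneg w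
  constructor
  · have hsum : liftReal ψ z - Psi ψ D z.fst ≤ C₁ * ‖w‖ ^ 2 := by
      unfold liftReal Psi
      rw [← Finset.sum_sub_distrib, Finset.sum_mul]
      refine Finset.sum_le_sum fun i _ => ?_
      obtain ⟨-, h2', h2⟩ := happ i
      rw [psi_infDist_sq (ψ := ψ) (hp i), hw.weight i, hψ.conjugate_rhoDeriv, EReal.toReal_coe]
      set t := ‖z.fst - z.snd.fst i‖ ^ 2
      set σ := ‖z.fst - p i‖ ^ 2
      set s := w.snd.snd i + t
      -- As `u = ρ'(s)`, the summand splits into `ρ(t) - ρ(s) - ρ'(s)(t - s)`, quadratic in the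
      -- weight component `s - t` of `w`, and `ρ(σ) - ρ(t) ≤ -ρ'(σ)(t - σ)`, quadratic by the
      -- projection estimate.
      have h3 := hψ.rho_sub_tangent_le hL0 hL s t
      have h4 : (t - s) ^ 2 ≤ ‖w‖ ^ 2 := by
        rw [← sq_abs (t - s)]
        have : |t - s| = |w.snd.snd i| := by simp [s]
        rw [this]
        exact pow_le_pow_left₀ (abs_nonneg _) (abs_lift_weight_le w i) 2
      have h5 := hψ.rho_tangent_le σ t
      have h6 : -rhoDeriv ψ σ * (t - σ) ≤ l * (q i * ‖w‖) ^ 2 :=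
        mul_le_mul (hl (sq_nonneg _)) h2 h2' hl0
      nlinarith [mul_le_mul_of_nonneg_left h4 hL0]
    refine hsum.trans ?_
    gcongr
    linarith
  · intro hw1
    refine ⟨_, gradPsi_mem_regularSubdiff hψ h0 hc hD hp, ?_⟩
    have hdiff : ‖gradPsi ψ z.fst p - w.fst‖ ≤
        (∑ i, (2 * (L * (1 + q i ^ 2)) * R i + 2 * l * q i)) * ‖w‖ := by
      rw [hw.base, gradPsi, ← Finset.sum_sub_distrib, Finset.sum_mul]
      refine norm_sum_le_of_le _ fun i _ => ?_
      obtain ⟨h1, h1', h2⟩ := happ i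
      set t := ‖z.fst - z.snd.fst i‖ ^ 2
      set σ := ‖z.fst - p i‖ ^ 2
      have hdec : (-2 * rhoDeriv ψ σ) • (z.fst - p i) -
          (-2 * z.snd.snd i) • (z.fst - z.snd.fst i) =
          (2 * (z.snd.snd i - rhoDeriv ψ σ)) • (z.fst - z.snd.fst i) +
          (2 * -rhoDeriv ψ σ) • (z.snd.fst i - p i) := by module
      have h3 : |z.snd.snd i - rhoDeriv ψ σ| ≤ L * ((1 + q i ^ 2) * ‖w‖) := by
        rw [hw.weight i]
        refine (hL _ _).trans (mul_le_mul_of_nonneg_left ?_ hL0)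
        -- The assumption `‖w‖ ≤ 1` turns the quadratic error into a linear one.
        have h4 : (q i * ‖w‖) ^ 2 ≤ q i ^ 2 * ‖w‖ := by
          rw [mul_pow]
          exact mul_le_mul_of_nonneg_left (by nlinarith) (sq_nonneg _)
        calc |w.snd.snd i + t - σ| = |w.snd.snd i + (t - σ)| := by ring_nf
          _ ≤ |w.snd.snd i| + |t - σ| := abs_add_le _ _
          _ ≤ ‖w‖ + q i ^ 2 * ‖w‖ := by
            rw [abs_of_nonneg h1']
            exact add_le_add (abs_lift_weight_le w i) (h2.trans h4)
          _ = (1 + q i ^ 2) * ‖w‖ := by ring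
      have h5 : 0 ≤ -rhoDeriv ψ σ := by linarith [hψ.rhoDeriv_neg σ]
      rw [hdec]
      refine (norm_add_le _ _).trans ?_
      rw [norm_smul, norm_smul, Real.norm_eq_abs, Real.norm_eq_abs, abs_mul, abs_two,
        abs_of_nonneg (mul_nonneg zero_le_two h5)]
      calc 2 * |z.snd.snd i - rhoDeriv ψ σ| * ‖z.fst - z.snd.fst i‖ +
            2 * -rhoDeriv ψ σ * ‖z.snd.fst i - p i‖
          ≤ 2 * (L * ((1 + q i ^ 2) * ‖w‖)) * R i + 2 * l * (q i * ‖w‖) := by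
            gcongr
            · exact (hz2 i).le
            · exact hl (sq_nonneg _)
        _ = (2 * (L * (1 + q i ^ 2)) * R i + 2 * l * q i) * ‖w‖ := by ring
    have h1 := norm_le_norm_add_norm_sub' (gradPsi ψ z.fst p) w.fst
    have h2 := norm_lift_base_le w
    have h3 : 0 ≤ C₁ * ‖w‖ := by positivity
    calc ‖gradPsi ψ z.fst p‖ ≤ C₂ * ‖w‖ := by
          simp only [C₂, add_mul, one_mul]
          linarith
      _ ≤ (C₁ + C₂) * ‖w‖ := by linarith

end Estimates

/-- If `Ψ` has the KL property with exponent `θ ∈ [1/2, 1)`, then so does the lifted potential. -/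
theorem isKLFunctionExponent_liftedPotential {n m : ℕ}
    {D : Fin m → Set (EuclideanSpace ℝ (Fin n))}
    (hD_nonempty : ∀ i, (D i).Nonempty) (hD_closed : ∀ i, IsClosed (D i))
    (hD_convex : ∀ i, Convex ℝ (D i)) {ψ : ℝ → ℝ} (hψ : MemTheta ψ) {θ : ℝ}
    (hθ : θ ∈ Ico (1 / 2 : ℝ) 1)
    (hKL : IsKLFunctionExponent
      (fun x : EuclideanSpace ℝ (Fin n) => (Psi ψ D x : EReal)) θ) :
    IsKLFunctionExponent (fun z : LiftSpace n m => liftedPotential ψ D z) θ := by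
  have hθ0 : 0 ≤ θ := by linarith [hθ.1]
  refine ⟨isProper_liftedPotential hψ hD_nonempty, lowerSemicontinuous_liftedPotential hD_closed,
    fun a ha => ?_⟩
  obtain ⟨w₀, hw₀⟩ := ha
  have hsub {z w : LiftSpace n m} (hw : w ∈ limitingSubdiff
      (fun z : LiftSpace n m => liftedPotential ψ D z) z) : LiftSubgradient ψ D z w :=
    liftSubgradient_of_mem_limitingSubdiff hψ hD_closed hD_convex hw
  have haF := ((hsub hw₀).liftDom hψ).liftedPotential_eq
  by_cases hcrit : LiftSubgradient ψ D a 0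
  · obtain ⟨C, hC, hev⟩ := exists_error_bound hψ hD_nonempty hD_closed hD_convex hcrit
    -- The error bound at `a` itself with `w = 0` gives the nontrivial inequality.
    have hval : liftReal ψ a = Psi ψ D a.fst := by
      have h1 := (hev.self_of_nhds 0 hcrit).1
      have h2 := Psi_le_liftReal hψ hD_nonempty hD_closed hD_convex (hcrit.liftDom hψ)
      simp only [norm_zero, ne_eq, OfNat.ofNat_ne_zero, not_false_eq_true, zero_pow,
        mul_zero] at h1
      linarith
    rw [hval] at haF
    have hdom : a.fst ∈ domSubdiff
        (fun x : EuclideanSpace ℝ (Fin n) => (Psi ψ D x : EReal)) := by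
      choose p hp using fun i =>
        exists_isProjection (hD_nonempty i) (hD_closed i) (hD_convex i) a.fst
      exact ⟨_, regularSubdiff_subset_limitingSubdiff _ _
        (gradPsi_mem_regularSubdiff hψ hD_nonempty hD_closed hD_convex hp)⟩
    obtain ⟨κ, ν, hκ, hν, hκν⟩ :=
      KLPropertyExponent.exists_bound (a := a.fst) (α := Psi ψ D a.fst)
        (f := fun x : EuclideanSpace ℝ (Fin n) => (Psi ψ D x : EReal)) rfl (hKL.2.2 _ hdom)
    -- In `κ`, the 1 handles `‖w‖ > 1`, where `ν ≤ 1` keeps the left side at most 1; `C ^ θ` comes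
    -- from the gap `F - Ψ`, and `κ * C` from the KL property of `Ψ`.
    refine klPropertyExponent_of_bound hθ0 hθ.2 ⟨w₀, hw₀⟩ haF
      (κ := 1 + C ^ θ + κ * C) (ν := min ν 1) (by positivity) (lt_min hν one_pos) ?_
    filter_upwards [hev, (continuous_lift_base.tendsto a).eventually hκν]
      with z hz hz' w hw β hβ h1 h2
    have hzw := hsub hw
    rw [(hzw.liftDom hψ).liftedPotential_eq, EReal.coe_eq_coe_iff] at hβ
    have hle := Psi_le_liftReal hψ hD_nonempty hD_closed hD_convex (hzw.liftDom hψ)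
    rw [hβ] at hle
    obtain ⟨hz1, hz2⟩ := hz w hzw
    rw [hβ] at hz1
    have hs : 0 < β - Psi ψ D a.fst := sub_pos.2 h1
    have hsmall : β - Psi ψ D a.fst < min ν 1 := by linarith
    have hw0 := norm_nonneg w
    rcases le_or_gt ‖w‖ 1 with hw1 | hw1
    · obtain ⟨g, hg, hgw⟩ := hz2 hw1
      -- Here `θ ≥ 1/2` is essential: `‖w‖ ^ (2θ) ≤ ‖w‖` for `‖w‖ ≤ 1`.
      have hfirst : (C * ‖w‖ ^ 2) ^ θ ≤ C ^ θ * ‖w‖ := by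
        rw [Real.mul_rpow hC (by positivity), ← Real.rpow_natCast, ← Real.rpow_mul hw0]
        gcongr
        calc ‖w‖ ^ (((2 : ℕ) : ℝ) * θ) ≤ ‖w‖ ^ (1 : ℝ) :=
              Real.rpow_le_rpow_of_exponent_ge' hw0 hw1 zero_le_one
                (by push_cast; linarith [hθ.1])
          _ = ‖w‖ := Real.rpow_one _
      -- The value of `Ψ` may drop below its value at `a.fst`, where the KL inequality is silent;
      -- hence the positive part.
      have hsecond : (max (Psi ψ D z.fst - Psi ψ D a.fst) 0) ^ θ ≤ κ * C * ‖w‖ := by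
        rcases le_or_gt (Psi ψ D z.fst) (Psi ψ D a.fst) with h | h
        · rw [max_eq_right (sub_nonpos.2 h), Real.zero_rpow (by linarith [hθ.1])]
          positivity
        · rw [max_eq_left (sub_nonneg.2 h.le), mul_assoc]
          exact (hz' g (regularSubdiff_subset_limitingSubdiff _ _ hg) _ rfl h
            (by linarith [min_le_left ν 1])).trans (by gcongr)
      calc (β - Psi ψ D a.fst) ^ θ
          ≤ (C * ‖w‖ ^ 2 + max (Psi ψ D z.fst - Psi ψ D a.fst) 0) ^ θ := by
            refine Real.rpow_le_rpow hs.le ?_ hθ0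
            linarith [le_max_left (Psi ψ D z.fst - Psi ψ D a.fst) 0]
        _ ≤ (C * ‖w‖ ^ 2) ^ θ + (max (Psi ψ D z.fst - Psi ψ D a.fst) 0) ^ θ :=
            Real.rpow_add_le_add_rpow (by positivity) (le_max_right _ _) hθ0 hθ.2.le
        _ ≤ (1 + C ^ θ + κ * C) * ‖w‖ := by linarith
    · have h3 : (β - Psi ψ D a.fst) ^ θ ≤ 1 :=
        Real.rpow_le_one hs.le (by linarith [min_le_right ν 1]) hθ0
      have h4 : 0 ≤ C ^ θ * ‖w‖ := by positivity
      have h5 : 0 ≤ κ * C * ‖w‖ := by positivity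
      linarith
  -- The closed relation omits `(a, 0)`, hence a whole product neighbourhood of it: subgradients
  -- near `a` have norm at least some `ε > 0`.
  · have hopen := (isClosed_liftSubgradient (n := n) (m := m) hψ hD_closed).isOpen_compl.mem_nhds
      (x := (a, 0)) hcrit
    rw [nhds_prod_eq] at hopen
    obtain ⟨U, hU, V, hV, hUV⟩ := Filter.mem_prod_iff.1 hopen
    obtain ⟨ε, hε, hball⟩ := Metric.mem_nhds_iff.1 hV
    refine klPropertyExponent_of_bound hθ0 hθ.2 ⟨w₀, hw₀⟩ haF (κ := 1 / ε) (ν := 1)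
      (by positivity) one_pos ?_
    filter_upwards [hU] with z hz w hw β _ h1 h2
    have hεw : ε ≤ ‖w‖ := by
      by_contra! h
      exact hUV (mk_mem_prod hz (hball (mem_ball_zero_iff.2 h))) (hsub hw)
    calc (β - liftReal ψ a) ^ θ ≤ 1 :=
          Real.rpow_le_one (by linarith) (by linarith) hθ0
      _ = 1 / ε * ε := by field_simp
      _ ≤ 1 / ε * ‖w‖ := by gcongr

end KLLift

theorem mainTheorem5 (n m : ℕ) (D : Fin m → Set (EuclideanSpace ℝ (Fin n)))
    (hD_nonempty : ∀ i, (D i).Nonempty) (hD_closed : ∀ i, IsClosed (D i))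
    (hD_convex : ∀ i, Convex ℝ (D i))
    (ψ : ℝ → ℝ) (hψ : KLLift.MemTheta ψ) (hψ_strict : StrictConcaveOn ℝ (Set.Ici 0) ψ)
    (θ : ℝ) (hθ : θ ∈ Set.Ico (1 / 2 : ℝ) 1)
    (hKL : KLLift.IsKLFunctionExponent
      (fun x : EuclideanSpace ℝ (Fin n) => (KLLift.Psi ψ D x : EReal)) θ) :
    KLLift.IsKLFunctionExponent
      (fun z : KLLift.LiftSpace n m => KLLift.liftedPotential ψ D z) θ :=
  KLLift.isKLFunctionExponent_liftedPotential hD_nonempty hD_closed hD_convex hψ hθ hKL
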